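/- Let $d$ be the dimension, $|\cdot|$ the Euclidean norm on $\mathbb{R}^d$, and for $r>0$ let $B(x,r)$ be the open ball of $\mathbb{R}^d$ with center $x$ and radius $r$. For $R,M>0$ and $y_0\in\mathbb{R}^d$, we say that a map $f:\mathbb{R}^d\times\mathbb{R}^d\to\mathbb{R}^d$, with $f_x=f(x,\cdot)$, satisfies condition $\mathbf{G}(R,y_0,M)$ if (i) there exists $L\ge 0$ such that $|f_x(z_1)-f_x(z_2)|\le L|z_1-z_2|$ for all $x\in B(0,R)$ and $z_1,z_2\in\mathbb{R}^d$; (ii) there exists $\tilde M>0$ such that $B(y_0,M)\subset f_x(B(0,\tilde M))$ for all $x\in B(0,R)$. **Proposition.** Let $g:\mathbb{R}^d\times\mathbb{R}^d\to\mathbb{R}^d$ and $R>0$ be such that (a) there exists $L_R\ge 0$ with $|g(x,z_1)-g(x,z_2)|\le L_R|z_1-z_2|$ for all $x,z_1,z_2\in\mathbb{R}^d$ with $|x|\le R$; (b) $C_{R,0},C_{R,1}\ge 0$ are constants with $|g(x,z)|\le C_{R,0}+C_{R,1}|z|$ for all $x,z\in\mathbb{R}^d$ with $|x|\le R$. Let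 $b\in\mathbb{R}$ and $f(x,z)=bz+g(x,z)$. If $|b|>C_{R,1}$, then for every $M>0$ the map $f$ satisfies condition $\mathbf{G}(R,0,M)$, and in (ii) one can take $$\tilde M=\frac{M+C_{R,0}}{|b|-C_{R,1}}.$$ That is, the maps $f_x$, $x\in B(0,R)$, are Lipschitz with a common constant, $\tilde M > 0$, and $B(0,M)\subset f_x(B(0,\tilde M))$ for all $x\in B(0,R)$. -/

import Mathlib

/-- Assumption on a map `f : ℝᵈ × ℝᵈ → ℝᵈ` (curried, `f x = f(x, ·)`) with parameters
`R, M > 0` and `y₀ ∈ ℝᵈ`, and with the witness `Mt > 0` for the covering condition made explicit: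
(i) the maps `f x`, for `x` in the open ball `B(0, R)`, are Lipschitz with one common constant;
(ii) for every `x` in `B(0, R)`, `B(y₀, M)` is contained in the image of `B(0, Mt)` by `f x`. -/
structure UniformLipschitzCoveringWith {d : ℕ}
    (f : EuclideanSpace ℝ (Fin d) → EuclideanSpace ℝ (Fin d) → EuclideanSpace ℝ (Fin d))
    (R : ℝ) (y₀ : EuclideanSpace ℝ (Fin d)) (M Mt : ℝ) : Prop where
  R_pos : 0 < R
  M_pos : 0 < M
  lipschitz : ∃ L : ℝ, 0 ≤ L ∧ ∀ x ∈ Metric.ball (0 : EuclideanSpace ℝ (Fin d)) R,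
    ∀ z₁ z₂ : EuclideanSpace ℝ (Fin d), ‖f x z₁ - f x z₂‖ ≤ L * ‖z₁ - z₂‖
  Mt_pos : 0 < Mt
  covering : ∀ x ∈ Metric.ball (0 : EuclideanSpace ℝ (Fin d)) R,
    Metric.ball y₀ M ⊆ f x '' Metric.ball (0 : EuclideanSpace ℝ (Fin d)) Mt

/-- The same assumption with parameters `R, y₀, M` only: some witness radius exists. -/
def UniformLipschitzCovering {d : ℕ}
    (f : EuclideanSpace ℝ (Fin d) → EuclideanSpace ℝ (Fin d) → EuclideanSpace ℝ (Fin d))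
    (R : ℝ) (y₀ : EuclideanSpace ℝ (Fin d)) (M : ℝ) : Prop :=
  ∃ Mt : ℝ, UniformLipschitzCoveringWith f R y₀ M Mt

/-! Solving `b z + g(x, z) = y` means finding a zero of `z + k z` with `k z = b⁻¹ (g(x, z) - y)`, a
Lipschitz map whose growth slope `C₁ / |b|` is below one. Such a zero exists by a Brouwer-type
argument: cutting `k` off far away gives a map equal to the identity outside a ball, and if it had
no zero, pushing its values radially would give a Lipschitz retraction of a ball onto its sphere
(`exists_add_eq_zero_of_lipschitz_of_growth`, `exists_eq_zero_of_lipschitz_of_eq_self`). No such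
retraction `r = id + H` exists (`not_exists_lipschitz_retraction_sphere`): the integral of `det (1 +
t H')` over the ball is polynomial in `t` and equals the volume of the ball for small `t > 0`, hence
also at `t = 1`, where the integrand vanishes. The bound on `‖z‖` then follows from the equation
itself. -/

open MeasureTheory Metric Set
open scoped NNReal

/-! ### Determinants of perturbations of the identity. -/

section Determinant

/-- Lagrange interpolation of the polynomial `t ↦ det (1 + t A)`, evaluated at `t = 1`. -/
theorem LinearMap.det_one_add_eq_sum_basis {E : Type*} [AddCommGroup E] [Module ℝ E]
    [FiniteDimensional ℝ E] (A : E →ₗ[ℝ] E) {v : ℕ → ℝ} (hv : Function.Injective v) :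
    LinearMap.det (1 + A) = ∑ i ∈ Finset.range (Module.finrank ℝ E + 1),
      LinearMap.det (1 + v i • A) *
        (Lagrange.basis (Finset.range (Module.finrank ℝ E + 1)) v i).eval 1 := by
  classical
  let B := Module.finBasis ℝ E
  set a := LinearMap.toMatrix B B A with ha
  let p : Polynomial ℝ :=
    Matrix.det ((Polynomial.X : Polynomial ℝ) • a.map Polynomial.C +
      (1 : Matrix _ _ ℝ).map Polynomial.C)
  have hp : ∀ t : ℝ, p.eval t = LinearMap.det (1 + t • A) := by
    intro t
    rw [← LinearMap.det_toMatrix B, map_add, map_smul, LinearMap.toMatrix_one, ← ha,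
      ← Polynomial.coe_evalRingHom, RingHom.map_det]
    congr 1
    ext i j
    simp only [RingHom.mapMatrix_apply, Matrix.map_apply, Matrix.add_apply, Matrix.smul_apply,
      smul_eq_mul, Polynomial.coe_evalRingHom, Polynomial.eval_add, Polynomial.eval_mul,
      Polynomial.eval_X, Polynomial.eval_C]
    exact add_comm _ _
  have hdeg : p.degree < (Finset.range (Module.finrank ℝ E + 1)).card := by
    refine lt_of_le_of_lt Polynomial.degree_le_natDegree ?_
    rw [Finset.card_range]
    have := Polynomial.natDegree_det_X_add_C_le a 1
    rw [Fintype.card_fin] at this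
    exact_mod_cast Nat.lt_succ_of_le this
  have key := congrArg (Polynomial.eval (1 : ℝ))
    (Lagrange.eq_interpolate (hv.injOn) hdeg)
  rw [Lagrange.interpolate_apply, Polynomial.eval_finsetSum, hp, one_smul] at key
  simpa [hp] using key

/-- For `t` in `[0, 1]` the map `1 + t A` is injective, so its determinant never vanishes along this
path and keeps the sign it has at `t = 0`. -/
theorem ContinuousLinearMap.det_one_add_pos {E : Type*} [NormedAddCommGroup E]
    [NormedSpace ℝ E] [FiniteDimensional ℝ E] (A : E →L[ℝ] E) (hA : ‖A‖ < 1) :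
    0 < LinearMap.det (1 + (A : E →ₗ[ℝ] E)) := by
  have hne : ∀ t ∈ Icc (0 : ℝ) 1, LinearMap.det (1 + t • (A : E →ₗ[ℝ] E)) ≠ 0 := by
    intro t ht h0
    obtain ⟨x, hx, hx0⟩ := Submodule.exists_mem_ne_zero_of_ne_bot
      (LinearMap.bot_lt_ker_of_det_eq_zero h0).ne'
    have hxA : x = -(t • A x) := by
      have : x + t • A x = 0 := by simpa using hx
      exact eq_neg_of_add_eq_zero_left this
    have h1 : ‖x‖ ≤ t * (‖A‖ * ‖x‖) := by
      conv_lhs => rw [hxA]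
      rw [norm_neg, norm_smul, Real.norm_of_nonneg ht.1]
      exact mul_le_mul_of_nonneg_left (A.le_opNorm x) ht.1
    have h2 : 0 < ‖x‖ := norm_pos_iff.2 hx0
    nlinarith [ht.2, mul_nonneg (norm_nonneg A) h2.le, mul_pos (sub_pos.2 hA) h2]
  have hcont : Continuous fun t : ℝ => LinearMap.det (1 + t • (A : E →ₗ[ℝ] E)) := by
    have : Continuous fun t : ℝ => (1 + t • A : E →L[ℝ] E).det :=
      ContinuousLinearMap.continuous_det.comp (by fun_prop)
    simpa [ContinuousLinearMap.det] using this
  by_contra! hneg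
  have hmem : (0 : ℝ) ∈ Icc (LinearMap.det (1 + (1 : ℝ) • (A : E →ₗ[ℝ] E)))
      (LinearMap.det (1 + (0 : ℝ) • (A : E →ₗ[ℝ] E))) := by
    constructor
    · simpa using hneg
    · simp
  obtain ⟨t, ht, h⟩ := intermediate_value_Icc' zero_le_one hcont.continuousOn hmem
  exact hne t ht h

end Determinant

/-! ### The no-retraction theorem for Lipschitz maps. -/

section NoRetraction

variable {E : Type*} [NormedAddCommGroup E] [InnerProductSpace ℝ E] [FiniteDimensional ℝ E]
  [MeasurableSpace E] [BorelSpace E]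

omit [MeasurableSpace E] [BorelSpace E] in
/-- A Lipschitz perturbation of the identity with small constant, supported in a ball, maps the
ball bijectively onto itself. -/
theorem bijective_image_ball_of_lipschitz_perturbation {f : E → E} {c : ℝ≥0} {ρ : ℝ}
    (hf : ApproximatesLinearOn f ((ContinuousLinearEquiv.refl ℝ E : E ≃L[ℝ] E) : E →L[ℝ] E)
      univ c) (hc : c < 1) (hout : ∀ x ∉ ball (0 : E) ρ, f x = x) :
    Function.Injective f ∧ f '' ball 0 ρ = ball 0 ρ := by
  have hc' : Subsingleton E ∨
      c < ‖((ContinuousLinearEquiv.refl ℝ E).symm : E →L[ℝ] E)‖₊⁻¹ := by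
    rcases subsingleton_or_nontrivial E with h | h
    · exact Or.inl h
    · right
      have : ‖((ContinuousLinearEquiv.refl ℝ E).symm : E →L[ℝ] E)‖₊ = 1 := by
        ext
        exact ContinuousLinearMap.norm_id
      rwa [this, inv_one]
  have hinj : Function.Injective f := injOn_univ.1 (hf.injOn hc')
  have hsurj : Function.Surjective f := hf.surjective hc'
  refine ⟨hinj, Subset.antisymm ?_ ?_⟩
  · rintro _ ⟨x, hx, rfl⟩
    by_contra h
    exact h ((hinj (hout _ h)).symm ▸ hx)
  · intro y hy
    obtain ⟨x, rfl⟩ := hsurj y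
    refine ⟨x, ?_, rfl⟩
    by_contra h
    exact h (hout x h ▸ hy)

/-- For small `t`, `id + t H` permutes the ball and has positive Jacobian, so this is the change of
variables formula. By Rademacher the points of non-differentiability are null, and so is their
image. -/
theorem exists_integral_det_one_add_smul_fderiv_eq {H : E → E} {K : ℝ≥0} {ρ : ℝ}
    (hH : LipschitzWith K H) (hρ : 0 < ρ) (hout : ∀ x ∉ ball (0 : E) ρ, H x = 0) :
    ∃ ε : ℝ, 0 < ε ∧ ∀ t : ℝ, 0 < t → t < ε →
      IntegrableOn (fun x => LinearMap.det (1 + t • (fderiv ℝ H x : E →ₗ[ℝ] E)))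
        (ball 0 ρ ∩ {x | DifferentiableAt ℝ H x}) ∧
      ∫ x in ball 0 ρ ∩ {x | DifferentiableAt ℝ H x},
        LinearMap.det (1 + t • (fderiv ℝ H x : E →ₗ[ℝ] E)) = volume.real (ball (0 : E) ρ) := by
  set D := {x | DifferentiableAt ℝ H x}
  have hDm : MeasurableSet D := measurableSet_of_differentiableAt ℝ H
  have hnull : volume (ball 0 ρ \ D) = 0 :=
    measure_mono_null (fun x hx => hx.2) hH.ae_differentiableAt
  -- Any `m > 1` would do: the bound only serves to send null sets to null sets.
  have hev := addHaar_image_le_mul_of_det_lt (volume : Measure E)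
    ((ContinuousLinearEquiv.refl ℝ E : E ≃L[ℝ] E) : E →L[ℝ] E) (m := 2) (by
      have : ((ContinuousLinearEquiv.refl ℝ E : E ≃L[ℝ] E) : E →L[ℝ] E).det = 1 :=
        LinearMap.det_id
      rw [this]
      norm_num)
  obtain ⟨η, hη, hη'⟩ := (mem_nhdsGT_iff_exists_Ioo_subset).1 hev
  have hη0 : (0 : ℝ≥0) < η := hη
  have hK : (0 : ℝ) < K + 1 := by positivity
  -- `K + 1` instead of `K` keeps the constant `t * (K + 1)` positive even when `K = 0`.
  refine ⟨min (η / (K + 1)) (1 / (K + 1)), by positivity, fun t ht htε => ?_⟩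
  have ht1 : t * (K + 1) < η := (lt_div_iff₀ hK).1 (htε.trans_le (min_le_left _ _))
  have ht2 : t * (K + 1) < 1 := (lt_div_iff₀ hK).1 (htε.trans_le (min_le_right _ _))
  lift t to ℝ≥0 using ht.le
  have ht' : 0 < t := by exact_mod_cast ht
  have hc0 : 0 < t * (K + 1) := by positivity
  have hc1 : t * (K + 1) < 1 := by exact_mod_cast ht2
  have hcη : t * (K + 1) < η := by exact_mod_cast ht1
  let f : E → E := fun x => x + (t : ℝ) • H x
  have hf : ApproximatesLinearOn f ((ContinuousLinearEquiv.refl ℝ E : E ≃L[ℝ] E) : E →L[ℝ] E)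
      univ (t * (K + 1)) := by
    rw [ApproximatesLinearOn.approximatesLinearOn_iff_lipschitzOnWith]
    have h1 : (f - ((ContinuousLinearEquiv.refl ℝ E : E ≃L[ℝ] E) : E →L[ℝ] E)) =
        fun x => (t : ℝ) • H x := by
      ext1 x
      simp [f]
    rw [h1]
    refine LipschitzOnWith.of_dist_le_mul fun x _ y _ => ?_
    rw [dist_smul₀, Real.norm_of_nonneg ht.le]
    push_cast
    rw [mul_assoc]
    refine mul_le_mul_of_nonneg_left ((hH.dist_le_mul x y).trans ?_) ht.le
    nlinarith [dist_nonneg (x := x) (y := y)]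
  obtain ⟨hinj, himg⟩ := bijective_image_ball_of_lipschitz_perturbation hf hc1
    (ρ := ρ) (fun x hx => by simp [f, hout x hx])
  have hfnull : volume (f '' (ball 0 ρ \ D)) = 0 := by
    have := hη' ⟨hc0, hcη⟩ (ball 0 ρ \ D) f (hf.mono_set (subset_univ _))
    simpa [hnull] using this
  have hvol : volume.real (f '' (ball 0 ρ ∩ D)) = volume.real (ball (0 : E) ρ) := by
    have h : volume (f '' (ball 0 ρ ∩ D)) = volume (ball (0 : E) ρ) := by
      apply le_antisymm
      · exact measure_mono ((image_mono inter_subset_left).trans himg.le)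
      · conv_lhs => rw [← himg, ← inter_union_sdiff (ball (0 : E) ρ) D, image_union]
        exact (measure_union_le _ _).trans (by rw [hfnull, add_zero])
    simp [Measure.real, h]
  have hder : ∀ x ∈ ball (0 : E) ρ ∩ D,
      HasFDerivWithinAt f (1 + (t : ℝ) • fderiv ℝ H x) (ball 0 ρ ∩ D) x := fun x hx =>
    ((hasFDerivAt_id x).add
      ((show DifferentiableAt ℝ H x from hx.2).hasFDerivAt.const_smul (t : ℝ))).hasFDerivWithinAt
  have hcv := integral_image_eq_integral_abs_det_fderiv_smul (volume : Measure E)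
    (measurableSet_ball.inter hDm) hder hinj.injOn (fun _ => (1 : ℝ))
  have hdet : ∀ x : E, |(1 + (t : ℝ) • fderiv ℝ H x).det| • (1 : ℝ) =
      LinearMap.det (1 + (t : ℝ) • (fderiv ℝ H x : E →ₗ[ℝ] E)) := by
    intro x
    have hn : ‖(t : ℝ) • fderiv ℝ H x‖ < 1 := by
      rw [norm_smul, Real.norm_of_nonneg ht.le]
      have := norm_fderiv_le_of_lipschitz ℝ hH (x₀ := x)
      nlinarith
    have := ContinuousLinearMap.det_one_add_pos _ hn
    rw [smul_eq_mul, mul_one]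
    exact abs_of_pos this
  have hint : ∫ x in ball 0 ρ ∩ D,
      LinearMap.det (1 + (t : ℝ) • (fderiv ℝ H x : E →ₗ[ℝ] E)) =
        volume.real (ball (0 : E) ρ) := by
    rw [← hvol]
    simp_rw [hdet] at hcv
    simpa using hcv.symm
  refine ⟨?_, hint⟩
  -- A non-integrable function has integral zero by convention, whereas this integral is positive.
  refine not_imp_comm.1 integral_undef ?_
  rw [hint]
  exact (ENNReal.toReal_pos (measure_ball_pos _ _ hρ).ne' measure_ball_lt_top.ne).ne'

/-- There is no Lipschitz retraction of a ball onto its boundary sphere. -/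
theorem not_exists_lipschitz_retraction_sphere {r : E → E} {K : ℝ≥0} {ρ : ℝ} (hρ : 0 < ρ)
    (hr : LipschitzWith K r) (hout : ∀ x ∉ ball (0 : E) ρ, r x = x)
    (hin : ∀ x ∈ ball (0 : E) ρ, ‖r x‖ = ρ) : False := by
  have hH : LipschitzWith (K + 1) (fun x => r x - x) := hr.sub LipschitzWith.id
  obtain ⟨ε, hε, hint⟩ := exists_integral_det_one_add_smul_fderiv_eq hH hρ
    (fun x hx => by simp [hout x hx])
  set H : E → E := fun x => r x - x
  set S := ball 0 ρ ∩ {x | DifferentiableAt ℝ H x}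
  -- Distinct interpolation nodes; the shift by 2 keeps them strictly below `ε`.
  let v : ℕ → ℝ := fun i => ε / (i + 2)
  have hv : Function.Injective v := by
    intro i j hij
    simp only [v] at hij
    rw [div_eq_div_iff (by positivity) (by positivity)] at hij
    have := mul_left_cancel₀ hε.ne' hij
    exact_mod_cast (add_right_cancel this).symm
  have hv0 : ∀ i, 0 < v i := fun i => by positivity
  have hvε : ∀ i, v i < ε := fun i => by
    have : (0 : ℝ) ≤ i := by positivity
    exact div_lt_self hε (by linarith)
  have hzero : ∀ x ∈ S, LinearMap.det (1 + (fderiv ℝ H x : E →ₗ[ℝ] E)) = 0 := by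
    rintro x ⟨hx, hxd⟩
    have hrd : HasFDerivAt r (fderiv ℝ H x + 1) x := by
      have := (show DifferentiableAt ℝ H x from hxd).hasFDerivAt.add (hasFDerivAt_id x)
      refine this.congr_of_eventuallyEq (Filter.Eventually.of_forall fun y => ?_)
      simp [H]
    -- Since `‖r‖²` is constant on the ball, the range of `r'` is orthogonal to `r x ≠ 0`, so `r'`
    -- is not surjective.
    have horth : ∀ u, inner ℝ (r x) ((fderiv ℝ H x + 1) u) = 0 := by
      intro u
      have h1 := hrd.norm_sq
      have h2 : HasFDerivAt (fun y => ‖r y‖ ^ 2) (0 : E →L[ℝ] ℝ) x := by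
        refine (hasFDerivAt_const (ρ ^ 2) x).congr_of_eventuallyEq ?_
        filter_upwards [isOpen_ball.mem_nhds hx] with y hy
        rw [hin y hy]
      have := congrArg (fun L : E →L[ℝ] ℝ => L u) (h1.unique h2)
      have h3 : 2 * inner ℝ (r x) ((fderiv ℝ H x + 1) u) = 0 := by
        simpa [inner_add_right, mul_add] using this
      linarith
    by_contra hdet
    have hu : IsUnit (1 + (fderiv ℝ H x : E →ₗ[ℝ] E)) :=
      (LinearMap.isUnit_iff_isUnit_det _).2 (isUnit_iff_ne_zero.2 hdet)
    obtain ⟨u, hu⟩ := ((Module.End.isUnit_iff _).1 hu).2 (r x)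
    have h3 := horth u
    have h4 : (fderiv ℝ H x + 1) u = r x := by
      rw [← hu, add_comm]
      rfl
    rw [h4, real_inner_self_eq_norm_sq, hin x hx] at h3
    exact (pow_pos hρ 2).ne' h3
  set s := Finset.range (Module.finrank ℝ E + 1)
  have hsum : ∑ i ∈ s, (Lagrange.basis s v i).eval 1 = 1 := by
    rw [← Polynomial.eval_finsetSum, Lagrange.sum_basis hv.injOn ⟨0, by simp [s]⟩,
      Polynomial.eval_one]
  have h0 : ∫ x in S, LinearMap.det (1 + (fderiv ℝ H x : E →ₗ[ℝ] E)) = 0 :=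
    setIntegral_eq_zero_of_forall_eq_zero hzero
  have h1 : ∫ x in S, LinearMap.det (1 + (fderiv ℝ H x : E →ₗ[ℝ] E)) =
      volume.real (ball (0 : E) ρ) := by
    rw [integral_congr_ae (Filter.Eventually.of_forall fun x =>
      LinearMap.det_one_add_eq_sum_basis (fderiv ℝ H x : E →ₗ[ℝ] E) hv)]
    rw [integral_finsetSum _ fun i _ => (hint (v i) (hv0 i) (hvε i)).1.mul_const _]
    simp_rw [integral_mul_const]
    rw [Finset.sum_congr rfl fun i _ => by rw [(hint (v i) (hv0 i) (hvε i)).2],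
      ← Finset.mul_sum, hsum, mul_one]
  rw [h0] at h1
  exact (ENNReal.toReal_pos (measure_ball_pos _ _ hρ).ne' measure_ball_lt_top.ne).ne h1

end NoRetraction

/-! ### Zeros of Lipschitz maps. -/

section Zeros

variable {E : Type*} [NormedAddCommGroup E] [InnerProductSpace ℝ E]

/-- The radial projection onto the closed ball of radius `ρ` around the origin. -/
noncomputable def radialProjection (ρ : ℝ) (x : E) : E := (ρ / max ρ ‖x‖) • x

theorem radialProjection_of_le {ρ : ℝ} (hρ : 0 < ρ) {x : E} (hx : ‖x‖ ≤ ρ) :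
    radialProjection ρ x = x := by
  rw [radialProjection, max_eq_left hx, div_self hρ.ne', one_smul]

theorem radialProjection_of_ge {ρ : ℝ} {x : E} (hx : ρ ≤ ‖x‖) :
    radialProjection ρ x = (ρ / ‖x‖) • x := by
  rw [radialProjection, max_eq_right hx]

theorem norm_radialProjection_le {ρ : ℝ} (hρ : 0 < ρ) (x : E) : ‖radialProjection ρ x‖ ≤ ρ := by
  have hm : 0 < max ρ ‖x‖ := lt_max_of_lt_left hρ
  rw [radialProjection, norm_smul, Real.norm_of_nonneg (by positivity), div_mul_eq_mul_div,
    div_le_iff₀ hm]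
  exact mul_le_mul_of_nonneg_left (le_max_right _ _) hρ.le

theorem lipschitzWith_radialProjection {ρ : ℝ} (hρ : 0 < ρ) :
    LipschitzWith 2 (radialProjection ρ : E → E) := by
  refine LipschitzWith.of_dist_le_mul fun x y => ?_
  rw [dist_eq_norm, dist_eq_norm]
  have hmx : 0 < max ρ ‖x‖ := lt_max_of_lt_left hρ
  have hmy : 0 < max ρ ‖y‖ := lt_max_of_lt_left hρ
  have hd : radialProjection ρ x - radialProjection ρ y =
      (ρ / max ρ ‖x‖) • (x - y) +
        ((max ρ ‖y‖ - max ρ ‖x‖) / max ρ ‖x‖) • radialProjection ρ y := by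
    simp only [radialProjection, smul_smul, smul_sub]
    rw [sub_add, ← sub_smul]
    congr 2
    field_simp
    ring
  have h1 : ‖(ρ / max ρ ‖x‖) • (x - y)‖ ≤ ‖x - y‖ := by
    rw [norm_smul, Real.norm_of_nonneg (by positivity)]
    exact mul_le_of_le_one_left (norm_nonneg _) ((div_le_one hmx).2 (le_max_left _ _))
  have h2 : ‖((max ρ ‖y‖ - max ρ ‖x‖) / max ρ ‖x‖) • radialProjection ρ y‖ ≤ ‖x - y‖ := by
    have h3 : |max ρ ‖y‖ - max ρ ‖x‖| ≤ ‖x - y‖ := by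
      have : |max ρ ‖y‖ - max ρ ‖x‖| ≤ |‖y‖ - ‖x‖| := by
        simpa using abs_max_sub_max_le_max ρ ‖y‖ ρ ‖x‖
      rw [norm_sub_rev]
      exact this.trans (abs_norm_sub_norm_le y x)
    rw [norm_smul, Real.norm_eq_abs, abs_div, abs_of_pos hmx, div_mul_eq_mul_div,
      div_le_iff₀ hmx]
    exact mul_le_mul h3 ((norm_radialProjection_le hρ y).trans (le_max_left _ _))
      (norm_nonneg _) (norm_nonneg _)
  rw [hd]
  refine (norm_add_le _ _).trans ?_
  push_cast
  linarith

variable [FiniteDimensional ℝ E]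

/-- A Lipschitz map which is the identity outside a ball and maps the ball into its closure
has a zero. -/
theorem exists_eq_zero_of_lipschitz_of_eq_self {w : E → E} {K : ℝ≥0} {τ : ℝ} (hτ : 0 < τ)
    (hw : LipschitzWith K w) (hout : ∀ x, τ ≤ ‖x‖ → w x = x)
    (hin : ∀ x, ‖x‖ < τ → ‖w x‖ ≤ τ) : ∃ x, w x = 0 := by
  by_contra! hne
  obtain ⟨x₀, -, hx₀⟩ := (isCompact_closedBall (0 : E) τ).exists_isMinOn
    ⟨0, mem_closedBall_self hτ.le⟩ hw.continuous.norm.continuousOn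
  have hδ : 0 < min ‖w x₀‖ τ := lt_min (norm_pos_iff.2 (hne x₀)) hτ
  set δ := min ‖w x₀‖ τ
  have hδw : ∀ x, ‖x‖ < τ → δ ≤ ‖w x‖ := fun x hx =>
    (min_le_left _ _).trans (hx₀ (mem_closedBall_zero_iff.2 hx.le))
  have hδτ : δ ≤ τ := min_le_right _ _
  -- A globally Lipschitz map that is the identity for `‖u‖ ≥ τ` and equals `τ u / ‖u‖` for `δ ≤ ‖u‖
  -- ≤ τ`.
  let ψ : E → E := fun u => u + (τ / δ) • radialProjection δ u - radialProjection τ u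
  have hψ := ((LipschitzWith.id (α := E)).add
    ((lipschitzWith_smul (τ / δ)).comp (lipschitzWith_radialProjection hδ))).sub
      (lipschitzWith_radialProjection hτ)
  borelize E
  refine not_exists_lipschitz_retraction_sphere (r := ψ ∘ w) hτ (hψ.comp hw) ?_ ?_
  · intro x hx
    have hx' : τ ≤ ‖x‖ := by simpa using hx
    simp only [Function.comp_apply, hout x hx', ψ]
    rw [radialProjection_of_ge (hδτ.trans hx'), radialProjection_of_ge hx', smul_smul,
      ← mul_div_assoc, div_mul_cancel₀ _ hδ.ne', add_sub_cancel_right]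
  · intro x hx
    have hx' : ‖x‖ < τ := by simpa using hx
    have h0 : 0 < ‖w x‖ := norm_pos_iff.2 (hne x)
    simp only [Function.comp_apply, ψ]
    rw [radialProjection_of_ge (hδw x hx'), radialProjection_of_le hτ (hin x hx'), smul_smul,
      ← mul_div_assoc, div_mul_cancel₀ _ hδ.ne', add_sub_cancel_left, norm_smul,
      Real.norm_of_nonneg (by positivity), div_mul_cancel₀ _ h0.ne']

/-- A Lipschitz map whose growth is strictly less than linear with slope one has a fixed point
up to sign. -/
theorem exists_add_eq_zero_of_lipschitz_of_growth {k : E → E} {K : ℝ≥0} {a c : ℝ}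
    (hk : LipschitzWith K k) (ha : 0 ≤ a) (hc0 : 0 ≤ c) (hc : c < 1)
    (hgrowth : ∀ x, ‖k x‖ ≤ a + c * ‖x‖) : ∃ x, x + k x = 0 := by
  have hc' : 0 < 1 - c := sub_pos.2 hc
  set ρ := (a + 1) / (1 - c) with hρdef
  have hρ : 0 < ρ := by positivity
  have hρeq : ρ * (1 - c) = a + 1 := div_mul_cancel₀ _ hc'.ne'
  have hbig : ∀ s, ρ ≤ s → a + c * s < s := fun s hs => by nlinarith
  have hσ : 0 < ρ + 1 := by positivity
  set σ := ρ + 1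
  -- Cutoff equal to 1 on `‖x‖ ≤ ρ` and 0 on `‖x‖ ≥ σ`.
  let χ : E → ℝ := fun x => min 1 (max 0 (σ - ‖x‖))
  have hχ0 : ∀ x, 0 ≤ χ x := fun x => le_min zero_le_one (le_max_left _ _)
  have hχ1 : ∀ x, χ x ≤ 1 := fun x => min_le_left _ _
  have hχd : ∀ x y, |χ x - χ y| ≤ ‖x - y‖ := by
    intro x y
    have h1 : |χ x - χ y| ≤ |max 0 (σ - ‖x‖) - max 0 (σ - ‖y‖)| := by
      simpa [χ, min_comm] using
        abs_min_sub_min_le_max (1 : ℝ) (max 0 (σ - ‖x‖)) 1 (max 0 (σ - ‖y‖))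
    have h2 : |max 0 (σ - ‖x‖) - max 0 (σ - ‖y‖)| ≤ |(σ - ‖x‖) - (σ - ‖y‖)| := by
      simpa using abs_max_sub_max_le_max (0 : ℝ) (σ - ‖x‖) 0 (σ - ‖y‖)
    refine h1.trans (h2.trans ?_)
    rw [sub_sub_sub_cancel_left, norm_sub_rev]
    exact abs_norm_sub_norm_le y x
  -- Truncating `k` makes it bounded, so that its product with `χ` is Lipschitz.
  let h : E → E := fun x => k (radialProjection σ x)
  have hC : 0 ≤ a + c * σ := by positivity
  have hh : ∀ x, ‖h x‖ ≤ a + c * σ := fun x =>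
    (hgrowth _).trans (by gcongr; exact norm_radialProjection_le hσ x)
  have hhL : LipschitzWith (K * 2) h := hk.comp (lipschitzWith_radialProjection hσ)
  have hχh : LipschitzWith (K * 2 + (a + c * σ).toNNReal) fun x => χ x • h x := by
    refine LipschitzWith.of_dist_le_mul fun x y => ?_
    have h1 : χ x • h x - χ y • h y = χ x • (h x - h y) + (χ x - χ y) • h y := by
      rw [smul_sub, sub_smul]
      abel
    have h2 := hhL.dist_le_mul x y
    rw [dist_eq_norm, dist_eq_norm] at *
    rw [h1]
    refine (norm_add_le _ _).trans ?_
    rw [norm_smul, norm_smul, Real.norm_of_nonneg (hχ0 x), Real.norm_eq_abs, NNReal.coe_add,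
      add_mul, Real.coe_toNNReal _ hC, mul_comm (a + c * σ)]
    exact add_le_add ((mul_le_of_le_one_left (norm_nonneg _) (hχ1 x)).trans h2)
      (mul_le_mul (hχd x y) (hh y) (norm_nonneg _) (norm_nonneg _))
  have hχout : ∀ x, σ ≤ ‖x‖ → χ x = 0 := fun x hx => by
    simp only [χ]
    rw [max_eq_left (by linarith), min_eq_right zero_le_one]
  have hnorm : ∀ x, ‖χ x • h x‖ ≤ ‖h x‖ := fun x => by
    rw [norm_smul, Real.norm_of_nonneg (hχ0 x)]
    exact mul_le_of_le_one_left (norm_nonneg _) (hχ1 x)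
  obtain ⟨x, hx⟩ := exists_eq_zero_of_lipschitz_of_eq_self (w := fun x => x + χ x • h x)
    (τ := σ + (a + c * σ)) (by positivity) (LipschitzWith.id.add hχh)
    (fun x hx => by
      rw [hχout x (by linarith), zero_smul, add_zero])
    (fun x hx => by
      rcases le_total σ ‖x‖ with hxσ | hxσ
      · rw [hχout x hxσ, zero_smul, add_zero]
        exact hx.le
      · exact (norm_add_le _ _).trans (add_le_add hxσ ((hnorm x).trans (hh x))))
  -- The growth bound forces the zero into the region where `χ = 1` and `h = k`.
  have hxn : ‖x‖ = ‖χ x • h x‖ := by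
    rw [eq_neg_of_add_eq_zero_left hx, norm_neg, ← eq_neg_of_add_eq_zero_left hx]
  have hxσ : ‖x‖ < σ := by
    by_contra! hge
    rw [hχout x hge, zero_smul, norm_zero] at hxn
    linarith
  have hhx : h x = k x := by simp only [h, radialProjection_of_le hσ hxσ.le]
  have hxρ : ‖x‖ < ρ := by
    by_contra! hge
    have h1 := hnorm x
    rw [← hxn, hhx] at h1
    linarith [hbig _ hge, hgrowth x]
  have hχx : χ x = 1 := min_eq_left (le_max_of_le_right (by simp only [σ]; linarith))
  refine ⟨x, ?_⟩
  simpa [hχx, hhx] using hx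

end Zeros

/-! ### The covering property. -/

theorem mainTheorem5 {d : ℕ}
    (g : EuclideanSpace ℝ (Fin d) → EuclideanSpace ℝ (Fin d) → EuclideanSpace ℝ (Fin d))
    (R : ℝ) (hR : 0 < R)
    (hLip : ∃ L : ℝ, 0 ≤ L ∧ ∀ z₁ z₂ x : EuclideanSpace ℝ (Fin d), ‖x‖ ≤ R →
      ‖g x z₁ - g x z₂‖ ≤ L * ‖z₁ - z₂‖)
    (C₀ C₁ : ℝ) (hC₀ : 0 ≤ C₀) (hC₁ : 0 ≤ C₁)
    (hgrowth : ∀ x z : EuclideanSpace ℝ (Fin d), ‖x‖ ≤ R → ‖g x z‖ ≤ C₀ + C₁ * ‖z‖)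
    (b : ℝ) (hb : C₁ < |b|) :
    ∀ M : ℝ, 0 < M →
      UniformLipschitzCovering (fun x z => b • z + g x z) R 0 M ∧
      UniformLipschitzCoveringWith (fun x z => b • z + g x z) R 0 M ((M + C₀) / (|b| - C₁)) := by
  intro M hM
  suffices h : UniformLipschitzCoveringWith (fun x z => b • z + g x z) R 0 M
      ((M + C₀) / (|b| - C₁)) from ⟨⟨_, h⟩, h⟩
  obtain ⟨L, hL, hLip⟩ := hLip
  have hb0 : 0 < |b| := hC₁.trans_lt hb
  have hbne : b ≠ 0 := abs_pos.1 hb0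
  have hbC : 0 < |b| - C₁ := sub_pos.2 hb
  refine ⟨hR, hM, ⟨|b| + L, by positivity, fun x hx z₁ z₂ => ?_⟩, by positivity, ?_⟩
  · have hxR : ‖x‖ ≤ R := (mem_ball_zero_iff.1 hx).le
    have h : b • z₁ + g x z₁ - (b • z₂ + g x z₂) = b • (z₁ - z₂) + (g x z₁ - g x z₂) := by
      rw [smul_sub]
      abel
    rw [h, add_mul]
    refine (norm_add_le _ _).trans (add_le_add ?_ (hLip z₁ z₂ x hxR))
    rw [norm_smul, Real.norm_eq_abs]
  · intro x hx y hy
    have hxR : ‖x‖ ≤ R := (mem_ball_zero_iff.1 hx).le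
    have hyM : ‖y‖ < M := mem_ball_zero_iff.1 hy
    obtain ⟨z, hz⟩ := exists_add_eq_zero_of_lipschitz_of_growth
      (k := fun z => b⁻¹ • (g x z - y)) (K := (|b|⁻¹ * L).toNNReal)
      (a := |b|⁻¹ * (C₀ + ‖y‖)) (c := |b|⁻¹ * C₁)
      (LipschitzWith.of_dist_le_mul fun z₁ z₂ => by
        rw [Real.coe_toNNReal _ (by positivity), dist_eq_norm, dist_eq_norm, ← smul_sub,
          sub_sub_sub_cancel_right, norm_smul, norm_inv, Real.norm_eq_abs, mul_assoc]
        exact mul_le_mul_of_nonneg_left (hLip z₁ z₂ x hxR) (by positivity))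
      (by positivity) (by positivity) (by rwa [inv_mul_lt_iff₀ hb0, mul_one])
      (fun z => by
        rw [norm_smul, norm_inv, Real.norm_eq_abs, mul_assoc, ← mul_add]
        refine mul_le_mul_of_nonneg_left ?_ (by positivity)
        linarith [norm_sub_le (g x z) y, hgrowth x z hxR])
    have hzy : b • z + g x z = y := by
      have h := congrArg (fun u => b • u) hz
      simp only [smul_add, smul_inv_smul₀ hbne, smul_zero] at h
      rw [← sub_eq_zero, ← h]
      abel
    refine ⟨z, ?_, hzy⟩
    -- From `b z = y - g(x, z)`: `|b| ‖z‖ ≤ ‖y‖ + C₀ + C₁ ‖z‖` with `‖y‖ < M`, which is where the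
    -- radius comes from.
    rw [mem_ball_zero_iff, lt_div_iff₀ hbC]
    have h1 : |b| * ‖z‖ ≤ ‖y‖ + ‖g x z‖ := by
      rw [← Real.norm_eq_abs, ← norm_smul, eq_sub_of_add_eq hzy]
      exact norm_sub_le _ _
    linarith [hgrowth x z hxR]
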